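/- Call a set in the plane $\mathbb{R}^2$ \emph{spanned} between two distinct horizontal lines if it is contained in the closed strip between the lines and meets each of them. Call a set spanned between the lines \emph{quasi-convex} if it is connected and contains a segment with one endpoint on each of the two lines. An on-line coloring algorithm receives sets one after the other and must immediately and irrevocably give each set a color that depends only on this set and on the sequence of sets presented before it; intersecting sets must receive different colors. There is an on-line algorithm that colors every finite sequence of convex sets spanned between two horizontal lines, given as subsets of the plane, with $O(\omega^3)$ colors, where $\omega$ is the clique number of the intersection graph of the sequence ($\omega$ is not known to the algorithm). More precisely, the algorithm uses at most $\binom{\omega+1}{2}\cdot 24\,\omega$ colors, and it properly colors, within the same bound, every finite sequence of quasi-convex sets spanned between two horizontal lines. -/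

import Mathlib

/-- The set `V` in the plane is spanned between the horizontal lines `y = a` and `y = b`: it is
contained in the strip between the two lines and meets each of them. -/
def IsSpanned (a b : ℝ) (V : Set (ℝ × ℝ)) : Prop :=
  (∀ p ∈ V, a ≤ p.2 ∧ p.2 ≤ b) ∧ (∃ p ∈ V, p.2 = a) ∧ (∃ p ∈ V, p.2 = b)

/-- `V` is a convex set spanned between the lines `y = a` and `y = b`. -/
def IsConvexSpanned (a b : ℝ) (V : Set (ℝ × ℝ)) : Prop :=
  IsSpanned a b V ∧ Convex ℝ V

/-- `V` is a quasi-convex set spanned between the lines `y = a` and `y = b`: it is connected and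
contains a segment that has its endpoints on the two lines. -/
def IsQuasiConvexSpanned (a b : ℝ) (V : Set (ℝ × ℝ)) : Prop :=
  IsSpanned a b V ∧ IsConnected V ∧
    ∃ x y : ℝ, segment ℝ ((x, a) : ℝ × ℝ) ((y, b) : ℝ × ℝ) ⊆ V

/-- The intersection graph of a finite sequence of sets: the vertices are the terms of the
sequence, two different terms being adjacent when they have a common point. -/
def intersectionGraph {X : Type*} {n : ℕ} (v : Fin n → Set X) : SimpleGraph (Fin n) where
  Adj i j := i ≠ j ∧ (v i ∩ v j).Nonempty
  symm := ⟨fun i j h => ⟨h.1.symm, by rw [Set.inter_comm]; exact h.2⟩⟩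
  loopless := ⟨fun _ h => h.1 rfl⟩

/-- A (deterministic) on-line colouring algorithm for sets given geometrically: the colour of a
new set is a function of the list of the sets presented before it, in the order of presentation,
and of the new set itself. Colours are natural numbers. -/
abbrev OnlineAlgorithm : Type :=
  List (Set (ℝ × ℝ)) → Set (ℝ × ℝ) → ℕ

/-- The colour that the algorithm gives to the `i`-th set of the sequence `v` when the sets of `v`
are presented one after the other. -/
def OnlineAlgorithm.run (A : OnlineAlgorithm) {n : ℕ} (v : Fin n → Set (ℝ × ℝ)) (i : Fin n) : ℕ :=
  A ((List.ofFn v).take i) (v i)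

/-- On every finite sequence of sets from the class `P`, the algorithm `A` gives different colours
to intersecting sets, and it uses only the `f ω` colours `0, …, f ω - 1`, where `ω` is the clique
number of the intersection graph of the sequence. The algorithm does not know `ω` or the length of
the sequence. -/
def OnlineAlgorithm.ColorsWith (A : OnlineAlgorithm) (P : Set (ℝ × ℝ) → Prop) (f : ℕ → ℕ) : Prop :=
  ∀ (n : ℕ) (v : Fin n → Set (ℝ × ℝ)), (∀ i, P (v i)) →
    (∀ i j, (intersectionGraph v).Adj i j → A.run v i ≠ A.run v j) ∧
    ∀ i, A.run v i < f (intersectionGraph v).cliqueNum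

/-! Choose in each set a segment joining the two lines, its base; the choice depends on the set
alone, so an algorithm that is not told `a` and `b` can make it.

`BaseCross` is a preorder whose chains are cliques. Recording the longest presented chains that
start and end at a set gives at most `ω * ω` classes, and sets with crossing bases never share a
class (`crossClass_ne_of_baseCross`). Inside a class the bases are therefore ordered from left to
right.

By connectedness, a set that reaches a base hits every base in between, so a base is hit by at most
`2 * ω` sets of its class (`card_hitsBase_le`). The Kierstead-Trotter rule splits the class into at
most `2 * ω` levels, in which each set hits a base that no other set of its level hits
(`exists_private_column`). In the order of these private bases only consecutive sets of a level can
meet, since a private base strictly between two others separates their owners. So a set has at most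
two neighbours in its level, and first-fit needs three colours. -/

/-- The height of the lower boundary line of a spanned set. -/
noncomputable def lowerLine (V : Set (ℝ × ℝ)) : ℝ := sInf (Prod.snd '' V)

/-- The height of the upper boundary line of a spanned set. -/
noncomputable def upperLine (V : Set (ℝ × ℝ)) : ℝ := sSup (Prod.snd '' V)

/-- The abscissas of the endpoints of a chosen segment in `V` between its boundary lines. -/
noncomputable def baseEnds (V : Set (ℝ × ℝ)) : ℝ × ℝ :=
  Classical.epsilon fun q : ℝ × ℝ => segment ℝ (q.1, lowerLine V) (q.2, upperLine V) ⊆ V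

/-- The chosen segment of `V` between its boundary lines. -/
noncomputable def base (V : Set (ℝ × ℝ)) : Set (ℝ × ℝ) :=
  segment ℝ ((baseEnds V).1, lowerLine V) ((baseEnds V).2, upperLine V)

/-- The base of `U` lies strictly to the left of the base of `W`. -/
def BaseLt (U W : Set (ℝ × ℝ)) : Prop :=
  (baseEnds U).1 < (baseEnds W).1 ∧ (baseEnds U).2 < (baseEnds W).2

/-- The base of `U` starts weakly to the left and ends weakly to the right of the base of `W`. -/
def BaseCross (U W : Set (ℝ × ℝ)) : Prop :=
  (baseEnds U).1 ≤ (baseEnds W).1 ∧ (baseEnds W).2 ≤ (baseEnds U).2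

/-- The set `U` meets the base of `W`. -/
def HitsBase (U W : Set (ℝ × ℝ)) : Prop := (U ∩ base W).Nonempty

theorem BaseCross.trans {U V W : Set (ℝ × ℝ)} (h : BaseCross U V) (h' : BaseCross V W) :
    BaseCross U W := ⟨h.1.trans h'.1, h'.2.trans h.2⟩

theorem baseLt_or_baseLt {U W : Set (ℝ × ℝ)} (h : ¬ BaseCross U W) (h' : ¬ BaseCross W U) :
    BaseLt U W ∨ BaseLt W U := by
  unfold BaseCross at h h'
  unfold BaseLt
  grind

theorem IsConvexSpanned.isQuasiConvexSpanned {a b : ℝ} {V : Set (ℝ × ℝ)}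
    (h : IsConvexSpanned a b V) : IsQuasiConvexSpanned a b V := by
  obtain ⟨hs, hc⟩ := h
  obtain ⟨-, ⟨⟨x, p⟩, hp, rfl⟩, ⟨⟨y, q⟩, hq, rfl⟩⟩ := id hs
  exact ⟨hs, hc.isConnected ⟨_, hp⟩, x, y, hc.segment_subset hp hq⟩

/-! ### Planar topology: connected sets and bases -/

section Strip

variable {a b : ℝ} {U V W Z : Set (ℝ × ℝ)}

theorem IsQuasiConvexSpanned.lowerLine_eq (h : IsQuasiConvexSpanned a b V) : lowerLine V = a := by
  obtain ⟨⟨hs, ⟨p, hp, hpa⟩, -⟩, -⟩ := h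
  refine IsLeast.csInf_eq ⟨⟨p, hp, hpa⟩, ?_⟩
  rintro _ ⟨q, hq, rfl⟩
  exact (hs q hq).1

theorem IsQuasiConvexSpanned.upperLine_eq (h : IsQuasiConvexSpanned a b V) : upperLine V = b := by
  obtain ⟨⟨hs, -, ⟨p, hp, hpa⟩⟩, -⟩ := h
  refine IsGreatest.csSup_eq ⟨⟨p, hp, hpa⟩, ?_⟩
  rintro _ ⟨q, hq, rfl⟩
  exact (hs q hq).2

theorem IsQuasiConvexSpanned.base_eq (h : IsQuasiConvexSpanned a b V) :
    base V = segment ℝ ((baseEnds V).1, a) ((baseEnds V).2, b) := by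
  rw [base, h.lowerLine_eq, h.upperLine_eq]

theorem IsQuasiConvexSpanned.base_subset (h : IsQuasiConvexSpanned a b V) : base V ⊆ V := by
  have : ∃ q : ℝ × ℝ, segment ℝ (q.1, lowerLine V) (q.2, upperLine V) ⊆ V := by
    rw [h.lowerLine_eq, h.upperLine_eq]
    obtain ⟨x, y, hxy⟩ := h.2.2
    exact ⟨(x, y), hxy⟩
  exact Classical.epsilon_spec this

theorem IsQuasiConvexSpanned.lower_mem_base (h : IsQuasiConvexSpanned a b V) :
    ((baseEnds V).1, a) ∈ base V := by
  rw [h.base_eq]; exact left_mem_segment _ _ _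

theorem IsQuasiConvexSpanned.upper_mem_base (h : IsQuasiConvexSpanned a b V) :
    ((baseEnds V).2, b) ∈ base V := by
  rw [h.base_eq]; exact right_mem_segment _ _ _

/-- The signed horizontal offset, scaled by `b - a`, of a point from the line through the base
of `V`. -/
noncomputable def baseOffset (a b : ℝ) (V : Set (ℝ × ℝ)) (p : ℝ × ℝ) : ℝ :=
  p.1 * (b - a) - ((baseEnds V).1 * (b - p.2) + (baseEnds V).2 * (p.2 - a))

theorem IsQuasiConvexSpanned.mem_base (hab : a < b) (h : IsQuasiConvexSpanned a b V) {p : ℝ × ℝ}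
    (ha : a ≤ p.2) (hb : p.2 ≤ b) (hp : baseOffset a b V p = 0) : p ∈ base V := by
  have hba : b - a ≠ 0 := (sub_pos.2 hab).ne'
  rw [h.base_eq]
  refine ⟨(b - p.2) / (b - a), (p.2 - a) / (b - a), div_nonneg (by linarith) (by linarith),
    div_nonneg (by linarith) (by linarith), by field_simp; ring, ?_⟩
  unfold baseOffset at hp
  ext
  · simp only [Prod.fst_add, Prod.smul_fst, smul_eq_mul]
    field_simp
    linarith
  · simp only [Prod.snd_add, Prod.smul_snd, smul_eq_mul]
    field_simp
    ring

/-- Intermediate value theorem for `baseOffset`, whose zeros in the strip all lie on the base. All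
the planar arguments reduce to this. -/
theorem IsPreconnected.inter_base_nonempty (hab : a < b) (hZ : IsQuasiConvexSpanned a b Z)
    (hU : IsPreconnected U) (hs : ∀ p ∈ U, a ≤ p.2 ∧ p.2 ≤ b) {p q : ℝ × ℝ} (hp : p ∈ U)
    (hq : q ∈ U) (hp0 : baseOffset a b Z p ≤ 0) (hq0 : 0 ≤ baseOffset a b Z q) :
    (U ∩ base Z).Nonempty := by
  have hc : Continuous (baseOffset a b Z) := by unfold baseOffset; fun_prop
  obtain ⟨r, hr, hr0⟩ := hU.intermediate_value hp hq hc.continuousOn ⟨hp0, hq0⟩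
  exact ⟨r, hr, hZ.mem_base hab (hs r hr).1 (hs r hr).2 hr0⟩

theorem IsQuasiConvexSpanned.baseOffset_pos (hab : a < b) (hW : IsQuasiConvexSpanned a b W)
    (h : BaseLt Z W) {p : ℝ × ℝ} (hp : p ∈ base W) : 0 < baseOffset a b Z p := by
  rw [hW.base_eq] at hp
  obtain ⟨s, t, hs, ht, hst, rfl⟩ := hp
  have : baseOffset a b Z (s • ((baseEnds W).1, a) + t • ((baseEnds W).2, b)) =
      (b - a) * (s * ((baseEnds W).1 - (baseEnds Z).1) +
        t * ((baseEnds W).2 - (baseEnds Z).2)) := by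
    obtain rfl : s = 1 - t := by linarith
    simp only [baseOffset, Prod.fst_add, Prod.smul_fst, smul_eq_mul, Prod.snd_add, Prod.smul_snd]
    ring
  rw [this]
  have h1 := sub_pos.2 h.1
  have h2 := sub_pos.2 h.2
  refine mul_pos (sub_pos.2 hab) ?_
  rcases hs.eq_or_lt with rfl | hs
  · obtain rfl : t = 1 := by linarith
    simpa using h.2
  · have := mul_pos hs h1
    have := mul_nonneg ht h2.le
    linarith

theorem IsQuasiConvexSpanned.baseOffset_neg (hab : a < b) (hW : IsQuasiConvexSpanned a b W)
    (h : BaseLt W Z) {p : ℝ × ℝ} (hp : p ∈ base W) : baseOffset a b Z p < 0 := by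
  rw [hW.base_eq] at hp
  obtain ⟨s, t, hs, ht, hst, rfl⟩ := hp
  have : baseOffset a b Z (s • ((baseEnds W).1, a) + t • ((baseEnds W).2, b)) =
      -((b - a) * (s * ((baseEnds Z).1 - (baseEnds W).1) +
        t * ((baseEnds Z).2 - (baseEnds W).2))) := by
    obtain rfl : s = 1 - t := by linarith
    simp only [baseOffset, Prod.fst_add, Prod.smul_fst, smul_eq_mul, Prod.snd_add, Prod.smul_snd]
    ring
  rw [this]
  have h1 := sub_pos.2 h.1
  have h2 := sub_pos.2 h.2
  refine neg_lt_zero.2 (mul_pos (sub_pos.2 hab) ?_)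
  rcases hs.eq_or_lt with rfl | hs
  · obtain rfl : t = 1 := by linarith
    simpa using h.2
  · have := mul_pos hs h1
    have := mul_nonneg ht h2.le
    linarith

theorem IsQuasiConvexSpanned.hitsBase_self (hU : IsQuasiConvexSpanned a b U) : HitsBase U U :=
  ⟨_, hU.base_subset hU.lower_mem_base, hU.lower_mem_base⟩

theorem HitsBase.inter_nonempty (hW : IsQuasiConvexSpanned a b W) (h : HitsBase U W) :
    (U ∩ W).Nonempty :=
  h.mono (Set.inter_subset_inter_right _ hW.base_subset)

theorem BaseCross.inter_nonempty (hab : a < b) (hU : IsQuasiConvexSpanned a b U)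
    (hW : IsQuasiConvexSpanned a b W) (h : BaseCross U W) : (U ∩ W).Nonempty := by
  have hc : IsPreconnected (base U) := (convex_segment _ _).isPreconnected
  refine (hc.inter_base_nonempty hab hW (fun p hp => hU.1.1 p (hU.base_subset hp))
    hU.lower_mem_base hU.upper_mem_base ?_ ?_).mono
    (Set.inter_subset_inter hU.base_subset hW.base_subset)
  · simp only [baseOffset]
    nlinarith [h.1]
  · simp only [baseOffset]
    nlinarith [h.2]

/-- `U` contains its own base, left of `Z`, and a point on the base of `W`, right of `Z`. -/
theorem HitsBase.of_baseLt_of_baseLt (hab : a < b) (hU : IsQuasiConvexSpanned a b U)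
    (hZ : IsQuasiConvexSpanned a b Z) (hW : IsQuasiConvexSpanned a b W) (h : HitsBase U W)
    (hUZ : BaseLt U Z) (hZW : BaseLt Z W) : HitsBase U Z := by
  obtain ⟨p, hpU, hpW⟩ := h
  exact hU.2.1.isPreconnected.inter_base_nonempty hab hZ hU.1.1
    (hU.base_subset hU.lower_mem_base) hpU (hU.baseOffset_neg hab hUZ hU.lower_mem_base).le
    (hW.baseOffset_pos hab hZW hpW).le

theorem HitsBase.of_baseLt_of_baseLt' (hab : a < b) (hU : IsQuasiConvexSpanned a b U)
    (hZ : IsQuasiConvexSpanned a b Z) (hW : IsQuasiConvexSpanned a b W) (h : HitsBase U W)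
    (hWZ : BaseLt W Z) (hZU : BaseLt Z U) : HitsBase U Z := by
  obtain ⟨p, hpU, hpW⟩ := h
  exact hU.2.1.isPreconnected.inter_base_nonempty hab hZ hU.1.1 hpU
    (hU.base_subset hU.lower_mem_base) (hW.baseOffset_neg hab hWZ hpW).le
    (hU.baseOffset_pos hab hZU hU.lower_mem_base).le

/-- The union of `U` and `W` is connected and has points on both sides of the base of `Z`. -/
theorem hitsBase_or_hitsBase_of_inter_nonempty (hab : a < b) (hU : IsQuasiConvexSpanned a b U)
    (hZ : IsQuasiConvexSpanned a b Z) (hW : IsQuasiConvexSpanned a b W) (h : (U ∩ W).Nonempty)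
    (hUZ : BaseLt U Z) (hZW : BaseLt Z W) : HitsBase U Z ∨ HitsBase W Z := by
  have hc : IsPreconnected (U ∪ W) := (hU.2.1.union h hW.2.1).isPreconnected
  have := hc.inter_base_nonempty hab hZ
    (by rintro p (hp | hp); exacts [hU.1.1 p hp, hW.1.1 p hp])
    (Or.inl (hU.base_subset hU.lower_mem_base)) (Or.inr (hW.base_subset hW.lower_mem_base))
    (hU.baseOffset_neg hab hUZ hU.lower_mem_base).le
    (hW.baseOffset_pos hab hZW hW.lower_mem_base).le
  rw [Set.union_inter_distrib_right] at this
  exact Set.union_nonempty.1 this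

/-- Two sets that hit the bases of `X` and `Y` are disjoint if some base between these two is hit
by neither of them. -/
theorem not_inter_nonempty_of_unhit_base {X Y : Set (ℝ × ℝ)} (hab : a < b)
    (hU : IsQuasiConvexSpanned a b U) (hW : IsQuasiConvexSpanned a b W)
    (hX : IsQuasiConvexSpanned a b X) (hY : IsQuasiConvexSpanned a b Y)
    (hZ : IsQuasiConvexSpanned a b Z) (hUX : HitsBase U X) (hWY : HitsBase W Y)
    (hUZ : ¬ HitsBase U Z) (hWZ : ¬ HitsBase W Z) (hXZ : BaseLt X Z) (hZY : BaseLt Z Y)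
    (hcU : U ≠ Z → BaseLt U Z ∨ BaseLt Z U) (hcW : W ≠ Z → BaseLt W Z ∨ BaseLt Z W) :
    ¬ (U ∩ W).Nonempty := by
  intro h
  have hU' : BaseLt U Z := by
    refine (hcU ?_).resolve_right fun h1 => hUZ (hUX.of_baseLt_of_baseLt' hab hU hZ hX hXZ h1)
    rintro rfl
    exact hUZ hU.hitsBase_self
  have hW' : BaseLt Z W := by
    refine (hcW ?_).resolve_left fun h1 => hWZ (hWY.of_baseLt_of_baseLt hab hW hZ hY h1 hZY)
    rintro rfl
    exact hWZ hW.hitsBase_self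
  exact (hitsBase_or_hitsBase_of_inter_nonempty hab hU hZ hW h hU' hW').elim hUZ hWZ

end Strip

/-! ### Chain heights -/

/-- `S` is an `R`-chain contained in `{0, …, i}` in which `i` comes first. -/
def IsChainFrom (R : ℕ → ℕ → Prop) (i : ℕ) (S : Finset ℕ) : Prop :=
  (∀ j ∈ S, j ≤ i) ∧ i ∈ S ∧ (∀ j ∈ S, R i j) ∧ ∀ j ∈ S, ∀ k ∈ S, R j k ∨ R k j

open Classical in
/-- The largest size of an `R`-chain contained in `{0, …, i}` in which `i` comes first. -/
noncomputable def chainHeight (R : ℕ → ℕ → Prop) (i : ℕ) : ℕ :=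
  ((Finset.range (i + 1)).powerset.filter (IsChainFrom R i)).sup Finset.card

theorem chainHeight_congr {R R' : ℕ → ℕ → Prop} {i : ℕ}
    (h : ∀ j ≤ i, ∀ k ≤ i, (R j k ↔ R' j k)) : chainHeight R i = chainHeight R' i := by
  classical
  unfold chainHeight
  congr 1
  refine Finset.filter_congr fun S _ => and_congr_right fun hS => ?_
  refine and_congr Iff.rfl (and_congr ?_ ?_)
  · exact forall₂_congr fun j hj => h i le_rfl j (hS j hj)
  · exact forall₂_congr fun j hj => forall₂_congr fun k hk =>
      or_congr (h j (hS j hj) k (hS k hk)) (h k (hS k hk) j (hS j hj))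

theorem IsChainFrom.card_le {R : ℕ → ℕ → Prop} {i : ℕ} {S : Finset ℕ} (h : IsChainFrom R i S) :
    S.card ≤ chainHeight R i := by
  classical
  refine Finset.le_sup (f := Finset.card) (Finset.mem_filter.2 ⟨Finset.mem_powerset.2 ?_, h⟩)
  exact fun j hj => Finset.mem_range.2 (Nat.lt_succ_iff.2 (h.1 j hj))

theorem exists_card_eq_chainHeight {R : ℕ → ℕ → Prop} {i : ℕ} (hi : R i i) :
    ∃ S : Finset ℕ, IsChainFrom R i S ∧ S.card = chainHeight R i := by
  classical
  have hne : ((Finset.range (i + 1)).powerset.filter (IsChainFrom R i)).Nonempty :=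
    ⟨{i}, by simp [IsChainFrom, hi]⟩
  obtain ⟨S, hS, hc⟩ := Finset.exists_mem_eq_sup _ hne Finset.card
  exact ⟨S, (Finset.mem_filter.1 hS).2, by rw [← hc]; rfl⟩

/-- A longest chain from `j` uses only indices up to `j`, so the later index `i` can be put in front
of it. -/
theorem chainHeight_lt_of_rel {R : ℕ → ℕ → Prop} (hr : ∀ i, R i i)
    (ht : ∀ i j k, R i j → R j k → R i k) {i j : ℕ} (hji : j < i) (h : R i j) :
    chainHeight R j < chainHeight R i := by
  obtain ⟨S, ⟨h1, h2, h3, h4⟩, h5⟩ := exists_card_eq_chainHeight (hr j)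
  have hi : i ∉ S := fun hi => absurd (h1 i hi) (by omega)
  have hR : ∀ k ∈ S, R i k := fun k hk => ht _ _ _ h (h3 k hk)
  rw [← h5, Nat.lt_iff_add_one_le, ← Finset.card_cons hi]
  refine IsChainFrom.card_le ⟨?_, Finset.mem_cons_self _ _, ?_, ?_⟩
  · simp only [Finset.forall_mem_cons]
    exact ⟨le_rfl, fun k hk => (h1 k hk).trans hji.le⟩
  · simp only [Finset.forall_mem_cons]
    exact ⟨hr i, hR⟩
  · simp only [Finset.forall_mem_cons]
    exact ⟨⟨Or.inl (hr i), fun k hk => Or.inl (hR k hk)⟩,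
      fun k hk => ⟨Or.inr (hR k hk), h4 k hk⟩⟩

/-! ### The Kierstead-Trotter greedy levels -/

/-- The level that the greedy rule of Kierstead and Trotter gives to `i`: the least `k` such that,
for all `j ≥ k`, each member of the class of `i` is `H`-hit by at most `j` members of the class when
only `i` and the earlier members of level at most `j` count as members. -/
noncomputable def greedyLevel {γ : Type*} (cls : ℕ → γ) (H : ℕ → ℕ → Prop) (i : ℕ) : ℕ :=
  sInf {k | ∀ j ≥ k, ∀ x, (x = i ∨ ∃ _ : x < i, cls x = cls i ∧ greedyLevel cls H x ≤ j) →
    ∀ S : Finset ℕ, (∀ u ∈ S, H u x ∧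
      (u = i ∨ ∃ _ : u < i, cls u = cls i ∧ greedyLevel cls H u ≤ j)) → S.card ≤ j}
  termination_by i

theorem greedyLevel_congr {γ : Type*} {cls cls' : ℕ → γ} {H H' : ℕ → ℕ → Prop} {i : ℕ}
    (hc : ∀ j ≤ i, cls j = cls' j) (hH : ∀ j ≤ i, ∀ k ≤ i, (H j k ↔ H' j k)) :
    greedyLevel cls H i = greedyLevel cls' H' i := by
  induction i using Nat.strong_induction_on with
  | _ i ih =>
    have key : ∀ j x, (x = i ∨ ∃ _ : x < i, cls x = cls i ∧ greedyLevel cls H x ≤ j) ↔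
        (x = i ∨ ∃ _ : x < i, cls' x = cls' i ∧ greedyLevel cls' H' x ≤ j) := by
      intro j x
      refine or_congr Iff.rfl (exists_congr fun hx => ?_)
      rw [hc x hx.le, hc i le_rfl, ih x hx (fun j hj => hc j (hj.trans hx.le))
        (fun j hj k hk => hH j (hj.trans hx.le) k (hk.trans hx.le))]
    have hle : ∀ j x, (x = i ∨ ∃ _ : x < i, cls' x = cls' i ∧ greedyLevel cls' H' x ≤ j) →
        x ≤ i := by
      rintro j x (rfl | ⟨hx, -⟩)
      exacts [le_rfl, hx.le]
    rw [greedyLevel, greedyLevel]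
    congr 1
    ext k
    refine forall₂_congr fun j _ => forall_congr' fun x => imp_congr_ctx (key j x) fun hx => ?_
    refine forall_congr' fun S => imp_congr_left (forall₂_congr fun u _ => ?_)
    rw [key]
    exact and_congr_left fun hu => hH u (hle j u hu) x (hle j x hx)

section Level

variable {γ : Type*} (cls : ℕ → γ) (H : ℕ → ℕ → Prop)

open Classical in
/-- The members of class `c` among `0, …, m - 1` whose greedy level is at most `k`. -/
noncomputable def levelMembers (m k : ℕ) (c : γ) : Finset ℕ :=
  (Finset.range m).filter fun u => cls u = c ∧ greedyLevel cls H u ≤ k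

theorem mem_levelMembers {m k : ℕ} {c : γ} {u : ℕ} :
    u ∈ levelMembers cls H m k c ↔ u < m ∧ cls u = c ∧ greedyLevel cls H u ≤ k := by
  simp [levelMembers]

open Classical in
/-- Each member of `T` is hit by at most `k` members of `T`. -/
def ThinColumns (H : ℕ → ℕ → Prop) (k : ℕ) (T : Finset ℕ) : Prop :=
  ∀ x ∈ T, (T.filter fun u => H u x).card ≤ k

-- The guards `∃ _ : x < i` of the recursive definition serve termination; here they become
-- membership in a finite set.
open Classical in
theorem greedyLevel_eq_sInf (i : ℕ) : greedyLevel cls H i =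
    sInf {k | ∀ j ≥ k, ThinColumns H j (insert i (levelMembers cls H i j (cls i)))} := by
  rw [greedyLevel]
  congr 1
  ext k
  have key : ∀ j u, (u = i ∨ ∃ _ : u < i, cls u = cls i ∧ greedyLevel cls H u ≤ j) ↔
      u ∈ insert i (levelMembers cls H i j (cls i)) := by
    simp [levelMembers, and_left_comm]
  refine forall₂_congr fun j _ => forall_congr' fun x => imp_congr (key j x) ?_
  constructor
  · exact fun h => h _ fun u hu => by
      rw [key]; exact (Finset.mem_filter.1 hu).symm
  · exact fun h S hS => (Finset.card_le_card fun u hu => 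
      Finset.mem_filter.2 ⟨(key j u).1 (hS u hu).2, (hS u hu).1⟩).trans h

open Classical in
theorem thinColumns_of_greedyLevel_le {i j : ℕ} (h : greedyLevel cls H i ≤ j) :
    ThinColumns H j (insert i (levelMembers cls H i j (cls i))) := by
  have hne : {k | ∀ j ≥ k,
      ThinColumns H j (insert i (levelMembers cls H i j (cls i)))}.Nonempty := by
    -- Only `i + 1` indices are involved, so thinness is automatic from `i + 1` on.
    refine ⟨i + 1, fun j hj x _ => (Finset.card_le_card (Finset.filter_subset _ _)).trans ?_⟩
    refine ((Finset.card_insert_le _ _).trans (Nat.succ_le_succ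
      ((Finset.card_le_card (Finset.filter_subset _ _)).trans ?_))).trans hj
    simp
  have := Nat.sInf_mem hne
  rw [← greedyLevel_eq_sInf] at this
  exact this j h

open Classical in
theorem greedyLevel_le {i k : ℕ}
    (h : ∀ j ≥ k, ThinColumns H j (insert i (levelMembers cls H i j (cls i)))) :
    greedyLevel cls H i ≤ k := by
  rw [greedyLevel_eq_sInf]
  exact Nat.sInf_le h

open Classical in
theorem not_thinColumns_of_greedyLevel_eq_succ {i k : ℕ} (h : greedyLevel cls H i = k + 1) :
    ¬ ThinColumns H k (insert i (levelMembers cls H i k (cls i))) := by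
  intro hk
  have : greedyLevel cls H i ≤ k := by
    refine greedyLevel_le cls H fun j hj => ?_
    rcases hj.eq_or_lt with rfl | hj
    · exact hk
    · exact thinColumns_of_greedyLevel_le cls H (by omega)
  omega

theorem thinColumns_levelMembers (m k : ℕ) (c : γ) :
    ThinColumns H k (levelMembers cls H m k c) := by
  classical
  induction m with
  | zero => intro x hx; simp [levelMembers] at hx
  | succ m ih =>
    by_cases hm : cls m = c ∧ greedyLevel cls H m ≤ k
    · have := thinColumns_of_greedyLevel_le cls H hm.2
      rw [hm.1] at this
      convert this using 1
      ext u
      simp only [levelMembers, Finset.mem_filter, Finset.mem_range, Finset.mem_insert]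
      grind
    · convert ih using 1
      ext u
      simp only [levelMembers, Finset.mem_filter, Finset.mem_range]
      grind

/-- Every vertex hits a vertex of its class that no other vertex of the same class and level hits. -/
theorem exists_private_column {n i : ℕ} (hi : i < n) (hH : H i i) :
    ∃ x < n, cls x = cls i ∧ H i x ∧
      ∀ u < n, cls u = cls i → greedyLevel cls H u = greedyLevel cls H i → u ≠ i → ¬ H u x := by
  classical
  obtain hk | ⟨k, hk⟩ : greedyLevel cls H i = 0 ∨ ∃ k, greedyLevel cls H i = k + 1 :=
    Nat.eq_zero_or_eq_succ_pred _ |>.imp id fun h => ⟨_, h⟩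
  · have := thinColumns_of_greedyLevel_le cls H hk.le i (Finset.mem_insert_self _ _)
    rw [Nat.le_zero, Finset.card_eq_zero, Finset.filter_eq_empty_iff] at this
    exact absurd hH (this (Finset.mem_insert_self _ _))
  -- Level `k` was refused to `i`: some column `x` has more than `k` hitters, `i` counted among the
  -- members.
  have hnot := not_thinColumns_of_greedyLevel_eq_succ cls H hk
  unfold ThinColumns at hnot
  push Not at hnot
  obtain ⟨x, hx, hcard⟩ := hnot
  have hxn : x < n ∧ cls x = cls i ∧ greedyLevel cls H x ≤ k + 1 := by
    rcases Finset.mem_insert.1 hx with rfl | hx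
    · exact ⟨hi, rfl, hk.le⟩
    · obtain ⟨h1, h2, h3⟩ := Finset.mem_filter.1 hx
      exact ⟨(Finset.mem_range.1 h1).trans hi, h2, by omega⟩
  -- Without `i` the column was thin, so `i` itself must be one of the hitters.
  have hHx : H i x := by
    by_contra hnH
    have hx' : x ∈ levelMembers cls H i k (cls i) :=
      (Finset.mem_insert.1 hx).resolve_left (by rintro rfl; exact hnH hH)
    have := thinColumns_levelMembers cls H i k (cls i) x hx'
    rw [Finset.filter_insert, if_neg hnH] at hcard
    omega
  refine ⟨x, hxn.1, hxn.2.1, hHx, fun u hu hcu hlu hui hHu => ?_⟩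
  have hthin := thinColumns_levelMembers cls H n (k + 1) (cls i) x
    (Finset.mem_filter.2 ⟨Finset.mem_range.2 hxn.1, hxn.2⟩)
  -- A further hitter `u` of level `k + 1`, earlier or later than `i`, would make at least `k + 2`
  -- hitters of level at most `k + 1`.
  have hu' : u ∉ (insert i (levelMembers cls H i k (cls i))).filter fun u => H u x := by
    simp only [levelMembers, Finset.mem_filter, Finset.mem_insert]
    grind
  have hsub : insert u ((insert i (levelMembers cls H i k (cls i))).filter fun u => H u x) ⊆
      (levelMembers cls H n (k + 1) (cls i)).filter fun u => H u x := by
    intro z hz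
    simp only [levelMembers, Finset.mem_filter, Finset.mem_insert, Finset.mem_range] at hz ⊢
    grind
  have := Finset.card_le_card hsub
  rw [Finset.card_insert_of_notMem hu'] at this
  omega

end Level

/-! ### First-fit colouring -/

/-- The first-fit colouring of the vertices `0, 1, …` with respect to the relation `E`. -/
noncomputable def firstFit (E : ℕ → ℕ → Prop) (i : ℕ) : ℕ :=
  sInf {c | ∀ j, ∀ _ : j < i, E j i → firstFit E j ≠ c}
  termination_by i

theorem firstFit_congr {E E' : ℕ → ℕ → Prop} {i : ℕ}
    (h : ∀ j ≤ i, ∀ k ≤ i, (E j k ↔ E' j k)) : firstFit E i = firstFit E' i := by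
  induction i using Nat.strong_induction_on with
  | _ i ih =>
    rw [firstFit, firstFit]
    congr 1
    ext c
    refine forall₂_congr fun j hj => ?_
    rw [h j hj.le i le_rfl, ih j hj fun k hk l hl => h k (hk.trans hj.le) l (hl.trans hj.le)]

open Classical in
theorem firstFit_notMem_image (E : ℕ → ℕ → Prop) (i : ℕ) :
    firstFit E i ∉ ((Finset.range i).filter fun j => E j i).image (firstFit E) ∧
      firstFit E i ≤ ((Finset.range i).filter fun j => E j i).card := by
  set N := (Finset.range i).filter fun j => E j i
  have heq : firstFit E i = sInf {c | c ∉ N.image (firstFit E)} := by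
    rw [firstFit]
    congr 1
    ext c
    simp only [Finset.mem_image, N, Finset.mem_filter, Finset.mem_range, Set.mem_ofPred_eq]
    grind
  obtain ⟨c, hc, hcN⟩ : ∃ c ∈ Finset.range (N.card + 1), c ∉ N.image (firstFit E) :=
    Finset.exists_mem_notMem_of_card_lt_card
      (by rw [Finset.card_range]; exact Nat.lt_succ_iff.2 Finset.card_image_le)
  have hmem : c ∈ {c | c ∉ N.image (firstFit E)} := hcN
  rw [heq]
  exact ⟨Nat.sInf_mem ⟨c, hmem⟩,
    (Nat.sInf_le hmem).trans (Nat.lt_succ_iff.1 (Finset.mem_range.1 hc))⟩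

theorem firstFit_ne {E : ℕ → ℕ → Prop} {i j : ℕ} (hj : j < i) (h : E j i) :
    firstFit E j ≠ firstFit E i := by
  classical
  exact fun he => (firstFit_notMem_image E i).1
    (Finset.mem_image.2 ⟨j, Finset.mem_filter.2 ⟨Finset.mem_range.2 hj, h⟩, he⟩)

theorem firstFit_lt_three {E : ℕ → ℕ → Prop} {i : ℕ}
    (h : ∀ j < i, ∀ k < i, ∀ l < i, E j i → E k i → E l i → j ≠ k → j ≠ l → k ≠ l → False) :
    firstFit E i < 3 := by
  classical
  refine (firstFit_notMem_image E i).2.trans_lt (not_le.1 fun h3 => ?_)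
  obtain ⟨j, k, l, hj, hk, hl, h1, h2, h3⟩ := Finset.two_lt_card_iff.1 h3
  simp only [Finset.mem_filter, Finset.mem_range] at hj hk hl
  exact h j hj.1 k hk.1 l hl.1 hj.2 hk.2 hl.2 h1 h2 h3

/-! ### Numbering the labels without knowing the clique number -/

/-- A set exhausted by an increasing sequence of finite sets `S k` can be numbered so that each
`S k` receives only numbers below its cardinality. -/
theorem exists_injective_lt_card {X : Type*} (S : ℕ → Finset X) (hS : Monotone S)
    (h0 : S 0 = ∅) (hX : ∀ x, ∃ k, x ∈ S k) :
    ∃ e : X → ℕ, Function.Injective e ∧ ∀ k, ∀ x ∈ S k, e x < (S k).card := by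
  classical
  have hr : ∀ x, ∃ k, x ∈ S (k + 1) ∧ x ∉ S k := by
    intro x
    have hpos : 0 < Nat.find (hX x) := by
      rw [Nat.find_pos, h0]
      exact Finset.notMem_empty _
    refine ⟨Nat.find (hX x) - 1, ?_, Nat.find_min (hX x) (by omega)⟩
    rw [Nat.sub_add_cancel hpos]
    exact Nat.find_spec (hX x)
  choose r hr1 hr2 using hr
  let D : ℕ → Finset X := fun k => S (k + 1) \ S k
  have hD : ∀ x, x ∈ D (r x) := fun x => Finset.mem_sdiff.2 ⟨hr1 x, hr2 x⟩
  -- The layers `S (k + 1) \ S k` receive consecutive blocks of numbers.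
  let e : X → ℕ := fun x => (S (r x)).card + (D (r x)).equivFin ⟨x, hD x⟩
  have hlt : ∀ x, e x < (S (r x + 1)).card := by
    intro x
    have h1 : ((D (r x)).equivFin ⟨x, hD x⟩ : ℕ) < (D (r x)).card := Fin.is_lt _
    have h2 : (D (r x)).card + (S (r x)).card = (S (r x + 1)).card :=
      Finset.card_sdiff_add_card_eq_card (hS (Nat.le_succ _))
    simp only [e]
    omega
  have hstrict : ∀ x y, r x < r y → e x < e y := fun x y h =>
    (hlt x).trans_le ((Finset.card_le_card (hS h)).trans (Nat.le_add_right _ _))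
  refine ⟨e, fun x y hxy => ?_, fun k x hx => (hlt x).trans_le (Finset.card_le_card (hS ?_))⟩
  · have hrxy : r x = r y := by
      rcases lt_trichotomy (r x) (r y) with h | h | h
      · exact absurd hxy (hstrict x y h).ne
      · exact h
      · exact absurd hxy (hstrict y x h).ne'
    have key : ∀ k (hx : x ∈ D k) (hy : y ∈ D k),
        ((D k).equivFin ⟨x, hx⟩ : ℕ) = (D k).equivFin ⟨y, hy⟩ → x = y := fun k hx hy h =>
      congrArg Subtype.val ((D k).equivFin.injective (Fin.ext h))
    refine key (r x) (hD x) (hrxy ▸ hD y) ?_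
    have h1 : ∀ k (hk : k = r y), ((D k).equivFin ⟨y, hk ▸ hD y⟩ : ℕ) =
        (D (r y)).equivFin ⟨y, hD y⟩ := by rintro _ rfl; rfl
    rw [h1 _ hrxy]
    simp only [e, hrxy] at hxy
    have h2 : ∀ k (hk : k = r x), ((D k).equivFin ⟨x, hk ▸ hD x⟩ : ℕ) =
        (D (r x)).equivFin ⟨x, hD x⟩ := by rintro _ rfl; rfl
    have h3 := h2 _ hrxy.symm
    omega
  · by_contra hk
    exact hr2 x (hS (by omega) hx)

/-! ### The on-line label and its dependence on the past only -/

/-- The pair formed by the largest numbers of presented sets with pairwise crossing bases among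
which the base of `w i` is leftmost, respectively rightmost, on the lower line. -/
noncomputable def crossClass (w : ℕ → Set (ℝ × ℝ)) (i : ℕ) : ℕ × ℕ :=
  (chainHeight (fun j k => BaseCross (w j) (w k)) i,
    chainHeight (fun j k => BaseCross (w k) (w j)) i)

/-- The greedy level of `w i` within its class. -/
noncomputable def hitLevel (w : ℕ → Set (ℝ × ℝ)) : ℕ → ℕ :=
  greedyLevel (crossClass w) fun j k => HitsBase (w j) (w k)

/-- Two sets of the sequence have the same class and level, and intersect. -/
def Conflict (w : ℕ → Set (ℝ × ℝ)) (i j : ℕ) : Prop :=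
  crossClass w i = crossClass w j ∧ hitLevel w i = hitLevel w j ∧ (w i ∩ w j).Nonempty

/-- The label of the `i`-th set: class, level and first-fit colour. -/
noncomputable def onlineLabel (w : ℕ → Set (ℝ × ℝ)) (i : ℕ) : ℕ × ℕ × ℕ :=
  ((crossClass w i).1 - 1, (crossClass w i).2 - 1, 3 * hitLevel w i + firstFit (Conflict w) i)

section Congr

variable {w w' : ℕ → Set (ℝ × ℝ)} {i : ℕ}

theorem crossClass_congr (h : ∀ j ≤ i, w j = w' j) : crossClass w i = crossClass w' i := by
  unfold crossClass
  congr 1 <;> exact chainHeight_congr fun j hj k hk => by rw [h j hj, h k hk]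

theorem hitLevel_congr (h : ∀ j ≤ i, w j = w' j) : hitLevel w i = hitLevel w' i :=
  greedyLevel_congr (fun _ hj => crossClass_congr fun k hk => h k (hk.trans hj))
    fun j hj k hk => by rw [h j hj, h k hk]

theorem onlineLabel_congr (h : ∀ j ≤ i, w j = w' j) : onlineLabel w i = onlineLabel w' i := by
  have hE : ∀ j ≤ i, ∀ k ≤ i, (Conflict w j k ↔ Conflict w' j k) := fun j hj k hk => by
    have hj' : ∀ l ≤ j, w l = w' l := fun l hl => h l (hl.trans hj)
    have hk' : ∀ l ≤ k, w l = w' l := fun l hl => h l (hl.trans hk)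
    unfold Conflict
    rw [crossClass_congr hj', crossClass_congr hk', hitLevel_congr hj', hitLevel_congr hk',
      h j hj, h k hk]
  rw [onlineLabel, onlineLabel, crossClass_congr h, hitLevel_congr h, firstFit_congr hE]

end Congr

/-! ### Correctness and size of the labels -/

section Analysis

variable {a b : ℝ} {n ω : ℕ} {w : ℕ → Set (ℝ × ℝ)}

theorem chainHeight_pos {R : ℕ → ℕ → Prop} {i : ℕ} (h : R i i) : 0 < chainHeight R i :=
  IsChainFrom.card_le (S := {i}) (by simp [IsChainFrom, h])

theorem crossClass_fst_pos (w : ℕ → Set (ℝ × ℝ)) (i : ℕ) : 0 < (crossClass w i).1 :=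
  chainHeight_pos (R := fun j k => BaseCross (w j) (w k)) (i := i) ⟨le_rfl, le_rfl⟩

theorem crossClass_snd_pos (w : ℕ → Set (ℝ × ℝ)) (i : ℕ) : 0 < (crossClass w i).2 :=
  chainHeight_pos (R := fun j k => BaseCross (w k) (w j)) (i := i) ⟨le_rfl, le_rfl⟩

/-- The later of the two sets prolongs a chain of the earlier one. The order of presentation decides
which coordinate grows. -/
theorem crossClass_ne_of_baseCross {i j : ℕ} (hij : i ≠ j) (h : BaseCross (w i) (w j)) :
    crossClass w i ≠ crossClass w j := by
  intro he
  obtain ⟨h1, h2⟩ := Prod.ext_iff.1 he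
  rcases hij.lt_or_gt with hij | hij
  · exact (chainHeight_lt_of_rel (R := fun j k => BaseCross (w k) (w j)) (fun _ => ⟨le_rfl, le_rfl⟩)
      (fun _ _ _ h h' => h'.trans h) hij h).ne h2
  · exact (chainHeight_lt_of_rel (R := fun j k => BaseCross (w j) (w k)) (fun _ => ⟨le_rfl, le_rfl⟩)
      (fun _ _ _ h h' => h.trans h') hij h).ne' h1

theorem baseLt_or_baseLt_of_crossClass_eq {i j : ℕ} (hij : i ≠ j)
    (h : crossClass w i = crossClass w j) : BaseLt (w i) (w j) ∨ BaseLt (w j) (w i) :=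
  baseLt_or_baseLt (fun h' => crossClass_ne_of_baseCross hij h' h)
    fun h' => crossClass_ne_of_baseCross hij.symm h' h.symm

theorem chainHeight_le_of_baseCross (hab : a < b) (hQ : ∀ i < n, IsQuasiConvexSpanned a b (w i))
    (hK : ∀ S : Finset ℕ, (∀ i ∈ S, i < n) →
      (∀ i ∈ S, ∀ j ∈ S, i ≠ j → (w i ∩ w j).Nonempty) → S.card ≤ ω)
    {R : ℕ → ℕ → Prop} (hr : ∀ i, R i i)
    (hR : ∀ j k, R j k → BaseCross (w j) (w k) ∨ BaseCross (w k) (w j)) {i : ℕ} (hi : i < n) :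
    chainHeight R i ≤ ω := by
  obtain ⟨S, ⟨h1, -, -, h4⟩, h5⟩ := exists_card_eq_chainHeight (hr i)
  have hn : ∀ j ∈ S, j < n := fun j hj => (h1 j hj).trans_lt hi
  rw [← h5]
  refine hK S hn fun j hj k hk _ => ?_
  have : BaseCross (w j) (w k) ∨ BaseCross (w k) (w j) :=
    (h4 j hj k hk).elim (hR j k) fun h => (hR k j h).symm
  rcases this with h | h
  · exact h.inter_nonempty hab (hQ j (hn j hj)) (hQ k (hn k hk))
  · rw [Set.inter_comm]
    exact h.inter_nonempty hab (hQ k (hn k hk)) (hQ j (hn j hj))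

-- The hitters whose base is that of `x` or lies to its left form a clique: of two of them, the left
-- one hits the base of the other on its way to `x`. The right side is symmetric.
open Classical in
theorem card_hitsBase_le (hab : a < b) (hQ : ∀ i < n, IsQuasiConvexSpanned a b (w i))
    (hK : ∀ S : Finset ℕ, (∀ i ∈ S, i < n) →
      (∀ i ∈ S, ∀ j ∈ S, i ≠ j → (w i ∩ w j).Nonempty) → S.card ≤ ω)
    {T : Finset ℕ} {c : ℕ × ℕ} (hT : ∀ i ∈ T, i < n ∧ crossClass w i = c) {x : ℕ} (hx : x ∈ T) :
    (T.filter fun u => HitsBase (w u) (w x)).card ≤ 2 * ω := by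
  have hQT : ∀ i ∈ T, IsQuasiConvexSpanned a b (w i) := fun i hi => hQ i (hT i hi).1
  have hlt : ∀ i ∈ T, ∀ j ∈ T, i ≠ j → BaseLt (w i) (w j) ∨ BaseLt (w j) (w i) :=
    fun i hi j hj hij =>
      baseLt_or_baseLt_of_crossClass_eq hij ((hT i hi).2.trans (hT j hj).2.symm)
  have hleft : (T.filter fun u => HitsBase (w u) (w x) ∧ (u = x ∨ BaseLt (w u) (w x))).card ≤ ω := by
    refine hK _ (fun i hi => (hT i (Finset.mem_filter.1 hi).1).1) ?_
    have key : ∀ i j, i ∈ T → j ∈ T → HitsBase (w i) (w x) → (j = x ∨ BaseLt (w j) (w x)) →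
        BaseLt (w i) (w j) → (w i ∩ w j).Nonempty := by
      rintro i j hi hj hix (rfl | hjx) hij
      · exact hix.inter_nonempty (hQT j hj)
      · exact (hix.of_baseLt_of_baseLt hab (hQT i hi) (hQT j hj) (hQT x hx) hij hjx).inter_nonempty
          (hQT j hj)
    intro i hi j hj hij
    obtain ⟨hi, hix, hi'⟩ := Finset.mem_filter.1 hi
    obtain ⟨hj, hjx, hj'⟩ := Finset.mem_filter.1 hj
    rcases hlt i hi j hj hij with h | h
    · exact key i j hi hj hix hj' h
    · rw [Set.inter_comm]
      exact key j i hj hi hjx hi' h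
  have hright : (T.filter fun u => HitsBase (w u) (w x) ∧ (u = x ∨ BaseLt (w x) (w u))).card ≤
      ω := by
    refine hK _ (fun i hi => (hT i (Finset.mem_filter.1 hi).1).1) ?_
    have key : ∀ i j, i ∈ T → j ∈ T → HitsBase (w i) (w x) → (j = x ∨ BaseLt (w x) (w j)) →
        BaseLt (w j) (w i) → (w i ∩ w j).Nonempty := by
      rintro i j hi hj hix (rfl | hjx) hij
      · exact hix.inter_nonempty (hQT j hj)
      · exact (hix.of_baseLt_of_baseLt' hab (hQT i hi) (hQT j hj) (hQT x hx) hjx hij).inter_nonempty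
          (hQT j hj)
    intro i hi j hj hij
    obtain ⟨hi, hix, hi'⟩ := Finset.mem_filter.1 hi
    obtain ⟨hj, hjx, hj'⟩ := Finset.mem_filter.1 hj
    rcases hlt i hi j hj hij with h | h
    · rw [Set.inter_comm]
      exact key j i hj hi hjx hi' h
    · exact key i j hi hj hix hj' h
  have hsub : (T.filter fun u => HitsBase (w u) (w x)) ⊆
      (T.filter fun u => HitsBase (w u) (w x) ∧ (u = x ∨ BaseLt (w u) (w x))) ∪
        T.filter fun u => HitsBase (w u) (w x) ∧ (u = x ∨ BaseLt (w x) (w u)) := by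
    intro u hu
    obtain ⟨hu, hux⟩ := Finset.mem_filter.1 hu
    simp only [Finset.mem_union, Finset.mem_filter]
    by_cases h : u = x
    · exact Or.inl ⟨hu, hux, Or.inl h⟩
    · exact (hlt u hu x hx h).imp (fun h => ⟨hu, hux, Or.inr h⟩) fun h => ⟨hu, hux, Or.inr h⟩
  have := (Finset.card_le_card hsub).trans (Finset.card_union_le _ _)
  omega

theorem hitLevel_le (hab : a < b) (hQ : ∀ i < n, IsQuasiConvexSpanned a b (w i))
    (hK : ∀ S : Finset ℕ, (∀ i ∈ S, i < n) →
      (∀ i ∈ S, ∀ j ∈ S, i ≠ j → (w i ∩ w j).Nonempty) → S.card ≤ ω) {i : ℕ} (hi : i < n) :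
    hitLevel w i ≤ 2 * ω := by
  classical
  refine greedyLevel_le _ _ fun j hj x hx => le_trans ?_ hj
  refine card_hitsBase_le (c := crossClass w i) hab hQ hK (fun u hu => ?_) hx
  rcases Finset.mem_insert.1 hu with rfl | hu
  · exact ⟨hi, rfl⟩
  · obtain ⟨h1, h2, -⟩ := (mem_levelMembers _ _).1 hu
    exact ⟨h1.trans hi, h2⟩

theorem firstFit_conflict_lt_three (hab : a < b) (hQ : ∀ i < n, IsQuasiConvexSpanned a b (w i))
    {i : ℕ} (hi : i < n) : firstFit (Conflict w) i < 3 := by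
  have hpriv : ∀ j, ∃ x, j < n → x < n ∧ crossClass w x = crossClass w j ∧ HitsBase (w j) (w x) ∧
      ∀ u < n, crossClass w u = crossClass w j → hitLevel w u = hitLevel w j → u ≠ j →
        ¬ HitsBase (w u) (w x) := by
    intro j
    by_cases hj : j < n
    · obtain ⟨x, hx⟩ := exists_private_column (crossClass w) (fun j k => HitsBase (w j) (w k)) hj
        (hQ j hj).hitsBase_self
      exact ⟨x, fun _ => hx⟩
    · exact ⟨0, fun h => absurd h hj⟩
  choose x hx using hpriv
  let M : Set ℕ := {j | j < n ∧ crossClass w j = crossClass w i ∧ hitLevel w j = hitLevel w i}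
  have hunhit : ∀ j ∈ M, ∀ k ∈ M, j ≠ k → ¬ HitsBase (w j) (w (x k)) :=
    fun j hj k hk hjk => (hx k hk.1).2.2.2 j hj.1 (hj.2.1.trans hk.2.1.symm)
      (hj.2.2.trans hk.2.2.symm) hjk
  have hcl : ∀ k ∈ M, crossClass w (x k) = crossClass w i :=
    fun k hk => (hx k hk.1).2.1.trans hk.2.1
  have hcmp : ∀ j ∈ M, ∀ k ∈ M, w j ≠ w (x k) →
      BaseLt (w j) (w (x k)) ∨ BaseLt (w (x k)) (w j) := fun j hj k hk h =>
    baseLt_or_baseLt_of_crossClass_eq (fun he => h (by rw [← he])) (hj.2.1.trans (hcl k hk).symm)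
  -- Private bases of distinct sets differ: `j` hits its own but not that of `k`.
  have htri : ∀ j ∈ M, ∀ k ∈ M, j ≠ k →
      BaseLt (w (x j)) (w (x k)) ∨ BaseLt (w (x k)) (w (x j)) := fun j hj k hk hjk =>
    baseLt_or_baseLt_of_crossClass_eq
      (fun he => hunhit j hj k hk hjk (he ▸ (hx j hj.1).2.2.1)) ((hcl j hj).trans (hcl k hk).symm)
  have hsep : ∀ j ∈ M, ∀ k ∈ M, ∀ l ∈ M, j ≠ k → l ≠ k → (w j ∩ w l).Nonempty →
      BaseLt (w (x j)) (w (x k)) → BaseLt (w (x k)) (w (x l)) → False :=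
    fun j hj k hk l hl hjk hlk hjl h1 h2 =>
      not_inter_nonempty_of_unhit_base hab (hQ j hj.1) (hQ l hl.1) (hQ _ (hx j hj.1).1)
        (hQ _ (hx l hl.1).1) (hQ _ (hx k hk.1).1) (hx j hj.1).2.2.1 (hx l hl.1).2.2.1
        (hunhit j hj k hk hjk) (hunhit l hl k hk hlk) h1 h2 (hcmp j hj k hk) (hcmp l hl k hk) hjl
  have hiM : i ∈ M := ⟨hi, rfl, rfl⟩
  -- At most one neighbour of `i` on each side: the nearer private base would separate `i` from the
  -- farther neighbour.
  have htwo : ∀ j ∈ M, ∀ k ∈ M, j ≠ k → j ≠ i → k ≠ i → (w j ∩ w i).Nonempty →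
      (w k ∩ w i).Nonempty →
      ¬ (BaseLt (w (x j)) (w (x i)) ∧ BaseLt (w (x k)) (w (x i))) ∧
      ¬ (BaseLt (w (x i)) (w (x j)) ∧ BaseLt (w (x i)) (w (x k))) := by
    intro j hj k hk hjk hji hki hjw hkw
    refine ⟨fun h => ?_, fun h => ?_⟩
    · rcases htri j hj k hk hjk with h' | h'
      · exact hsep j hj k hk i hiM hjk hki.symm hjw h' h.2
      · exact hsep k hk j hj i hiM hjk.symm hji.symm hkw h' h.1
    · rcases htri j hj k hk hjk with h' | h'
      · exact hsep i hiM j hj k hk hji.symm hjk.symm (by rwa [Set.inter_comm]) h.1 h'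
      · exact hsep i hiM k hk j hj hki.symm hjk (by rwa [Set.inter_comm]) h.2 h'
  refine firstFit_lt_three fun j hj k hk l hl hjE hkE hlE hjk hjl hkl => ?_
  have hM : ∀ u < i, Conflict w u i → u ∈ M := fun u hu h => ⟨hu.trans hi, h.1, h.2.1⟩
  have hjM := hM j hj hjE
  have hkM := hM k hk hkE
  have hlM := hM l hl hlE
  have h1 := htwo j hjM k hkM hjk hj.ne hk.ne hjE.2.2 hkE.2.2
  have h2 := htwo j hjM l hlM hjl hj.ne hl.ne hjE.2.2 hlE.2.2
  have h3 := htwo k hkM l hlM hkl hk.ne hl.ne hkE.2.2 hlE.2.2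
  have h4 := htri j hjM i hiM hj.ne
  have h5 := htri k hkM i hiM hk.ne
  have h6 := htri l hlM i hiM hl.ne
  rcases h4 with h4 | h4 <;> rcases h5 with h5 | h5
  · exact h1.1 ⟨h4, h5⟩
  · rcases h6 with h6 | h6
    exacts [h2.1 ⟨h4, h6⟩, h3.2 ⟨h5, h6⟩]
  · rcases h6 with h6 | h6
    exacts [h3.1 ⟨h5, h6⟩, h2.2 ⟨h4, h6⟩]
  · exact h1.2 ⟨h4, h5⟩

theorem onlineLabel_ne (hab : a < b) (hQ : ∀ i < n, IsQuasiConvexSpanned a b (w i)) {i j : ℕ}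
    (hi : i < n) (hj : j < n) (hij : i ≠ j) (h : (w i ∩ w j).Nonempty) :
    onlineLabel w i ≠ onlineLabel w j := by
  intro he
  simp only [onlineLabel, Prod.mk.injEq] at he
  obtain ⟨h1, h2, h3⟩ := he
  have hi3 := firstFit_conflict_lt_three hab hQ hi
  have hj3 := firstFit_conflict_lt_three hab hQ hj
  -- Heights are positive, so the truncated subtraction of `1` loses nothing; below, the first-fit
  -- colour is the remainder modulo `3`.
  have hc : crossClass w i = crossClass w j := by
    have := crossClass_fst_pos w i
    have := crossClass_fst_pos w j
    have := crossClass_snd_pos w i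
    have := crossClass_snd_pos w j
    ext <;> omega
  have hl : hitLevel w i = hitLevel w j := by omega
  have hf : firstFit (Conflict w) i = firstFit (Conflict w) j := by omega
  rcases hij.lt_or_gt with hlt | hlt
  · exact firstFit_ne hlt ⟨hc, hl, h⟩ hf
  · exact firstFit_ne hlt ⟨hc.symm, hl.symm, by rwa [Set.inter_comm]⟩ hf.symm

/-- The labels available for clique number `k`. -/
def labelsBelow (k : ℕ) : Finset (ℕ × ℕ × ℕ) :=
  Finset.range k ×ˢ Finset.range k ×ˢ Finset.range (9 * k)

theorem onlineLabel_mem (hab : a < b) (hQ : ∀ i < n, IsQuasiConvexSpanned a b (w i))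
    (hK : ∀ S : Finset ℕ, (∀ i ∈ S, i < n) →
      (∀ i ∈ S, ∀ j ∈ S, i ≠ j → (w i ∩ w j).Nonempty) → S.card ≤ ω) {i : ℕ} (hi : i < n) :
    onlineLabel w i ∈ labelsBelow ω := by
  have h1 : (crossClass w i).1 ≤ ω :=
    chainHeight_le_of_baseCross (R := fun j k => BaseCross (w j) (w k)) hab hQ hK
      (fun _ => ⟨le_rfl, le_rfl⟩) (fun _ _ h => Or.inl h) hi
  have h2 : (crossClass w i).2 ≤ ω :=
    chainHeight_le_of_baseCross (R := fun j k => BaseCross (w k) (w j)) hab hQ hK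
      (fun _ => ⟨le_rfl, le_rfl⟩) (fun _ _ h => Or.inr h) hi
  have := crossClass_fst_pos w i
  have := crossClass_snd_pos w i
  have := hitLevel_le hab hQ hK hi
  have := firstFit_conflict_lt_three hab hQ hi
  -- The last entry is at most `6 * ω + 2`, below `9 * ω` because positive heights force `1 ≤ ω`.
  simp only [labelsBelow, onlineLabel, Finset.mem_product, Finset.mem_range]
  omega

end Analysis

/-! ### Counting labels and assembling the algorithm -/

theorem labelsBelow_mono : Monotone labelsBelow := fun k l h x => by
  simp only [labelsBelow, Finset.mem_product, Finset.mem_range]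
  omega

theorem card_labelsBelow_le (k : ℕ) : (labelsBelow k).card ≤ (k + 1).choose 2 * (24 * k) := by
  have h : (k + 1).choose 2 * 2 = (k + 1) * k := by
    rw [Nat.choose_two_right, Nat.add_sub_cancel]
    exact Nat.div_mul_cancel (mul_comm k (k + 1) ▸ (Nat.even_mul_succ_self k).two_dvd)
  simp only [labelsBelow, Finset.card_product, Finset.card_range]
  calc k * (k * (9 * k)) ≤ (k + 1) * k * (12 * k) := by nlinarith [Nat.zero_le (k * k * k)]
    _ = (k + 1).choose 2 * (24 * k) := by rw [← h]; ring

theorem exists_injective_labelsBelow :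
    ∃ e : ℕ × ℕ × ℕ → ℕ, Function.Injective e ∧
      ∀ k, ∀ x ∈ labelsBelow k, e x < (labelsBelow k).card := by
  refine exists_injective_lt_card labelsBelow labelsBelow_mono rfl fun x => ?_
  refine ⟨x.1 + x.2.1 + x.2.2 + 1, ?_⟩
  simp only [labelsBelow, Finset.mem_product, Finset.mem_range]
  omega

/-- The algorithm that encodes the labels by `e`. -/
noncomputable def labelAlgorithm (e : ℕ × ℕ × ℕ → ℕ) : OnlineAlgorithm :=
  fun l V => e (onlineLabel (fun j => (l ++ [V]).getD j ∅) l.length)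

theorem labelAlgorithm_run (e : ℕ × ℕ × ℕ → ℕ) {n : ℕ} (v : Fin n → Set (ℝ × ℝ)) (i : Fin n) :
    (labelAlgorithm e).run v i = e (onlineLabel (fun j => (List.ofFn v).getD j ∅) i) := by
  have hlen : ((List.ofFn v).take i).length = i := by simp [i.2.le]
  have happ : (List.ofFn v).take i ++ [v i] = (List.ofFn v).take (i + 1) := by
    rw [List.take_add_one]
    simp
  rw [OnlineAlgorithm.run, labelAlgorithm, hlen, happ]
  -- The algorithm sees only the prefix up to `i`, and the label depends on nothing else.
  refine congrArg e (onlineLabel_congr fun j hj => ?_)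
  rw [List.getD_eq_getElem?_getD, List.getD_eq_getElem?_getD, List.getElem?_take_of_lt (by omega)]

theorem card_le_cliqueNum {X : Type*} {n : ℕ} (v : Fin n → Set X) {S : Finset ℕ}
    (hS : ∀ i ∈ S, i < n)
    (h : ∀ i j : Fin n, i.1 ∈ S → j.1 ∈ S → i ≠ j → (v i ∩ v j).Nonempty) :
    S.card ≤ (intersectionGraph v).cliqueNum := by
  rw [← Finset.card_attachFin S hS]
  refine SimpleGraph.IsClique.card_le_cliqueNum (tc := fun i hi j hj hij => ⟨hij, h i j ?_ ?_ hij⟩)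
  · simpa using hi
  · simpa using hj

theorem labelAlgorithm_colorsWith {e : ℕ × ℕ × ℕ → ℕ} (he : Function.Injective e)
    (hlt : ∀ k, ∀ x ∈ labelsBelow k, e x < (labelsBelow k).card) {a b : ℝ} (hab : a < b) :
    (labelAlgorithm e).ColorsWith (IsQuasiConvexSpanned a b)
      (fun ω => (ω + 1).choose 2 * (24 * ω)) := by
  intro n v hv
  set w : ℕ → Set (ℝ × ℝ) := fun j => (List.ofFn v).getD j ∅ with hw
  have hwv : ∀ i : Fin n, w i = v i := fun i => by simp [hw]
  have hQ : ∀ i < n, IsQuasiConvexSpanned a b (w i) := fun i hi => by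
    rw [hwv ⟨i, hi⟩]; exact hv _
  refine ⟨fun i j hij => ?_, fun i => ?_⟩
  · rw [labelAlgorithm_run, labelAlgorithm_run]
    refine he.ne (onlineLabel_ne hab hQ i.2 j.2 (Fin.val_ne_of_ne hij.1) ?_)
    rw [hwv, hwv]
    exact hij.2
  · rw [labelAlgorithm_run]
    refine (hlt _ _ (onlineLabel_mem hab hQ (fun S hS h => ?_) i.2)).trans_le
      (card_labelsBelow_le (intersectionGraph v).cliqueNum)
    refine card_le_cliqueNum v hS fun i j hi hj hij => ?_
    rw [← hwv, ← hwv]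
    exact h i hi j hj (Fin.val_ne_of_ne hij)

theorem OnlineAlgorithm.ColorsWith.mono {A : OnlineAlgorithm} {P Q : Set (ℝ × ℝ) → Prop}
    {f g : ℕ → ℕ} (h : A.ColorsWith P f) (hP : ∀ V, Q V → P V) (hf : ∀ k, f k ≤ g k) :
    A.ColorsWith Q g := fun n v hv =>
  have := h n v fun i => hP _ (hv i)
  ⟨this.1, fun i => (this.2 i).trans_le (hf _)⟩

theorem choose_two_mul_le (k : ℕ) : (k + 1).choose 2 * (24 * k) ≤ 24 * k ^ 3 := by
  have h : (k + 1).choose 2 ≤ k * k := by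
    rw [Nat.choose_two_right, Nat.add_sub_cancel]
    refine Nat.div_le_of_le_mul ?_
    rcases k.eq_zero_or_pos with rfl | hk
    · rfl
    · nlinarith
  calc (k + 1).choose 2 * (24 * k) ≤ k * k * (24 * k) := Nat.mul_le_mul_right _ h
    _ = 24 * k ^ 3 := by ring

theorem theorem1 :
    ∃ A : OnlineAlgorithm,
      (∃ C : ℕ, ∀ a b : ℝ, a < b →
        A.ColorsWith (IsConvexSpanned a b) (fun ω => C * ω ^ 3)) ∧
      (∀ a b : ℝ, a < b →
        A.ColorsWith (IsConvexSpanned a b) (fun ω => (ω + 1).choose 2 * (24 * ω))) ∧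
      (∀ a b : ℝ, a < b →
        A.ColorsWith (IsQuasiConvexSpanned a b) (fun ω => (ω + 1).choose 2 * (24 * ω))) := by
  obtain ⟨e, he, hlt⟩ := exists_injective_labelsBelow
  have h : ∀ a b : ℝ, a < b → (labelAlgorithm e).ColorsWith (IsQuasiConvexSpanned a b)
      (fun ω => (ω + 1).choose 2 * (24 * ω)) := fun a b => labelAlgorithm_colorsWith he hlt
  exact ⟨labelAlgorithm e,
    ⟨24, fun a b hab =>
      (h a b hab).mono (fun _ => IsConvexSpanned.isQuasiConvexSpanned) choose_two_mul_le⟩,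
    fun a b hab =>
      (h a b hab).mono (fun _ => IsConvexSpanned.isQuasiConvexSpanned) fun _ => le_rfl, h⟩
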